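/- Let $m\le p\le n$ and let $A_m\in\mathbb{R}^{n\times n}$, $B_m\in\mathbb{R}^{n\times m}$, $C_m\in\mathbb{R}^{p\times n}$ be such that $A_m$ is Hurwitz (all its eigenvalues have negative real part) and $(A_m,B_m,C_m)$ is a minimal realization (that is, $(A_m,B_m)$ is controllable and $(A_m,C_m)$ is observable) of the stable transfer matrix $M(s)=C_m(s\mathbb{I}_n-A_m)^{-1}B_m$. Suppose that $M(s)$ has full normal column rank $m$ (its rank over the field $\mathbb{R}(s)$ is $m$) and that $C_mB_m$ is rank deficient, i.e. $\operatorname{rank}(C_mB_m)<m$. Then there exist an integer $n_z\ge 0$ and matrices $A_z\in\mathbb{R}^{n_z\times n_z}$, $B_z\in\mathbb{R}^{n_z\times m}$, $C_z\in\mathbb{R}^{m\times n_z}$, $D_z\in\mathbb{R}^{m\times m}$, $\bar B\in\mathbb{R}^{n\times m}$, $T_z\in\mathbb{R}^{n\times n_z}$ such that $A_z$ is Hurwitz, $$\det\begin{bmatrix}-s\mathbb{I}_{n_z}+A_z & B_z\\ C_z & D_z\end{bmatrix}\neq 0\qquad\text{for all } s\in\mathbb{C},$$ the stable transfer matrix $Z(s)=C_z(s\mathbb{I}_{n_z}-A_z)^{-1}B_z+D_z$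 is invertible over $\mathbb{R}(s)$, $$\bar M(s):=C_m(s\mathbb{I}_n-A_m)^{-1}\bar B=M(s)Z^{-1}(s),$$ $$A_mT_z=T_zA_z+\bar BC_z,\qquad C_mA_mT_z=C_m\bar BC_z,\qquad B_m=T_zB_z+\bar BD_z,\qquad C_mB_m=C_m\bar BD_z,$$ and $T_z$ has full column rank $n_z$. Moreover, for these matrices: - $(A_m,\bar B)$ is controllable, and $C_m\bar B$ has full rank $m$; - if $M(s)$ has no unstable zeros, then $\bar M(s)$ has no unstable zeros. Here a zero of a transfer matrix with a minimal realization $(A,B,C)$, $A\in\mathbb{R}^{n\times n}$, is a transmission zero, that is, a number $s\in\mathbb{C}$ with $\operatorname{rank}\begin{bmatrix}-s\mathbb{I}_n+A&B\\C&0\end{bmatrix}<n+\min(m,p)$, and it is unstable if $\operatorname{Re}s\ge 0$; the realizations used are $(A_m,B_m,C_m)$ and $(A_m,\bar B,C_m)$, both of which are minimal. -/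

import Mathlib

namespace LTI

/-- The transfer matrix `C (s I - A)⁻¹ B + D` of the state-space system `(A, B, C, D)`, as a matrix
of real rational functions in the indeterminate `s`.  The determinant of `s I - A` is the
characteristic polynomial of `A`, so the inverse is a true inverse. -/
noncomputable def transferMatrix {n m p : ℕ} (A : Matrix (Fin n) (Fin n) ℝ)
    (B : Matrix (Fin n) (Fin m) ℝ) (C : Matrix (Fin p) (Fin n) ℝ) (D : Matrix (Fin p) (Fin m) ℝ) :
    Matrix (Fin p) (Fin m) (RatFunc ℝ) :=
  C.map (algebraMap ℝ (RatFunc ℝ)) *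
      (Matrix.scalar (Fin n) (RatFunc.X : RatFunc ℝ) - A.map (algebraMap ℝ (RatFunc ℝ)))⁻¹ *
      B.map (algebraMap ℝ (RatFunc ℝ)) +
    D.map (algebraMap ℝ (RatFunc ℝ))

/-- A real square matrix is Hurwitz if all its complex eigenvalues have negative real part. -/
def IsHurwitz {n : ℕ} (A : Matrix (Fin n) (Fin n) ℝ) : Prop :=
  ∀ z ∈ spectrum ℂ (A.map (algebraMap ℝ ℂ)), z.re < 0

/-- `(A, B)` is controllable: the controllability matrix `[B, A B, …, A ^ (n - 1) B]` has rank
`n`. -/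
def IsControllable {n m : ℕ} (A : Matrix (Fin n) (Fin n) ℝ) (B : Matrix (Fin n) (Fin m) ℝ) :
    Prop :=
  (Matrix.of fun (i : Fin n) (q : Fin n × Fin m) => (A ^ (q.1 : ℕ) * B) i q.2).rank = n

/-- `(A, C)` is observable: the observability matrix with block rows `C, C A, …, C A ^ (n - 1)`
has rank `n`. -/
def IsObservable {n p : ℕ} (A : Matrix (Fin n) (Fin n) ℝ) (C : Matrix (Fin p) (Fin n) ℝ) :
    Prop :=
  (Matrix.of fun (q : Fin n × Fin p) (i : Fin n) => (C * A ^ (q.1 : ℕ)) q.2 i).rank = n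

/-- `(A, B, C)` is a minimal realization (of its transfer matrix): it is controllable and
observable. -/
def IsMinimal {n m p : ℕ} (A : Matrix (Fin n) (Fin n) ℝ) (B : Matrix (Fin n) (Fin m) ℝ)
    (C : Matrix (Fin p) (Fin n) ℝ) : Prop :=
  IsControllable A B ∧ IsObservable A C

/-- The system matrix (Rosenbrock pencil) `[-s I + A, B; C, D]` at the complex number `s`. -/
noncomputable def systemMatrix {n m p : ℕ} (A : Matrix (Fin n) (Fin n) ℝ)
    (B : Matrix (Fin n) (Fin m) ℝ) (C : Matrix (Fin p) (Fin n) ℝ) (D : Matrix (Fin p) (Fin m) ℝ)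
    (s : ℂ) : Matrix (Fin n ⊕ Fin p) (Fin n ⊕ Fin m) ℂ :=
  Matrix.fromBlocks (-Matrix.scalar (Fin n) s + A.map (algebraMap ℝ ℂ)) (B.map (algebraMap ℝ ℂ))
    (C.map (algebraMap ℝ ℂ)) (D.map (algebraMap ℝ ℂ))

/-- `s` is a transmission zero of the system `(A, B, C, D)`: the system matrix at `s` has rank
smaller than `n + min m p`.  If the realization is minimal, these are the (transmission) zeros of
its transfer matrix. -/
def IsTransmissionZero {n m p : ℕ} (A : Matrix (Fin n) (Fin n) ℝ)
    (B : Matrix (Fin n) (Fin m) ℝ) (C : Matrix (Fin p) (Fin n) ℝ) (D : Matrix (Fin p) (Fin m) ℝ)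
    (s : ℂ) : Prop :=
  (systemMatrix A B C D s).rank < n + min m p

/-- The system has no unstable zeros: every transmission zero lies in the open left half-plane. -/
def NoUnstableZeros {n m p : ℕ} (A : Matrix (Fin n) (Fin n) ℝ)
    (B : Matrix (Fin n) (Fin m) ℝ) (C : Matrix (Fin p) (Fin n) ℝ) (D : Matrix (Fin p) (Fin m) ℝ) :
    Prop :=
  ∀ s : ℂ, IsTransmissionZero A B C D s → s.re < 0

end LTI

/-!
As long as `C * B` kills a vector `v`, the system `(A, B, C)` has a zero at infinity in the
direction `v`. Take a row `w` with `w v = 1`. The square system that acts as `1 / (s + a)` on `v`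
and as the identity on the kernel of `w` has no finite zeros, and it can be split off `(A, B, C)` on
the right: this replaces `B` by `B + (A + a - 1) B v w` and adjoins the column `B v` to the matrix
`T` that maps the states of the split-off part to those of `(A, B, C)`. Full normal rank forces the
columns of `T` to stay linearly independent, so there are at most `n` steps, and they end with
`C * B` injective.

The product `Z` of the factors has no finite zeros, and all its `k` poles are at `-a`. Solving for
the input of `Z` turns a zero of the quotient that is not a pole of `Z` into a zero of the original
system. If `-a` is not an eigenvalue of `A`, then `(A + a)^k` is invertible and removes the states
of `Z` from the picture, so that `q ↦ q (A + a)^k` embeds the functionals vanishing on the reachable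
space of the quotient into those vanishing on the reachable space of the original system.
-/

namespace LTI

open Matrix Function

/-- A linear time-invariant state-space system `(A, B, C, D)` over `K`, with states indexed by `ι`,
inputs by `κ` and outputs by `ρ`; bundled so that interconnections are operations on systems. -/
structure Realization (K ι κ ρ : Type*) where
  A : Matrix ι ι K
  B : Matrix ι κ K
  C : Matrix ρ ι K
  D : Matrix ρ κ K

namespace Realization

variable {K L ι ι' κ ρ σ : Type*} [Field K] [Field L]

/-- Extension of scalars; transfer matrices and transmission zeros of a real system live over
`RatFunc ℝ` and `ℂ`. -/
def map (f : K →+* L) (Z : Realization K ι κ ρ) : Realization L ι κ ρ :=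
  ⟨Z.A.map f, Z.B.map f, Z.C.map f, Z.D.map f⟩

/-- Relabelling of the states. -/
def reindex (e : ι ≃ ι') (Z : Realization K ι κ ρ) : Realization K ι' κ ρ :=
  ⟨Z.A.reindex e e, Z.B.reindex e (.refl κ), Z.C.reindex (.refl ρ) e, Z.D⟩

/-- The value at `s` of the transfer function, `C (s I - A)⁻¹ B + D`; the junk value `D` if `s`
is an eigenvalue of `A`. -/
noncomputable def transfer [Fintype ι] [DecidableEq ι] (Z : Realization K ι κ ρ) (s : K) :
    Matrix ρ κ K :=
  Z.C * (scalar ι s - Z.A)⁻¹ * Z.B + Z.D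

/-- The Rosenbrock pencil `[-s I + A, B; C, D]` at `s`. -/
def pencil [Fintype ι] [DecidableEq ι] (Z : Realization K ι κ ρ) (s : K) :
    Matrix (ι ⊕ ρ) (ι ⊕ κ) K :=
  fromBlocks (-scalar ι s + Z.A) Z.B Z.C Z.D

/-- The series connection in which the output of `Z₁` drives `Z₂`. -/
def series [Fintype ρ] (Z₁ : Realization K ι κ ρ) (Z₂ : Realization K ι' ρ σ) :
    Realization K (ι ⊕ ι') κ σ :=
  ⟨fromBlocks Z₁.A 0 (Z₂.B * Z₁.C) Z₂.A, fromRows Z₁.B (Z₂.B * Z₁.D),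
    fromCols (Z₂.D * Z₁.C) Z₂.C, Z₂.D * Z₁.D⟩

/-- The system `(-a, w, v, 1 - v w)`. If `w v = 1`, its transfer function acts as `1 / (s + a)` on
the range of `v` and as the identity on the kernel of `w`. -/
def firstOrder [Fintype ι] [DecidableEq ι] [DecidableEq κ] (a : K) (v : Matrix κ ι K)
    (w : Matrix ι κ K) : Realization K ι κ κ :=
  ⟨-a • 1, w, v, 1 - v * w⟩

end Realization

section Field

variable {K ι κ : Type*} [Field K] [Fintype κ]

theorem rank_eq_card_iff_mulVec_injective (M : Matrix ι κ K) :
    M.rank = Fintype.card κ ↔ Injective M.mulVec := by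
  rw [mulVec_injective_iff, linearIndependent_iff_card_eq_finrank_span, Set.finrank,
    rank_eq_finrank_span_cols, eq_comm]

theorem map_algebraMap_mulVec_injective_iff [Finite ι] {L : Type*} [Field L] [Algebra K L]
    {M : Matrix ι κ K} : Injective (M.map (algebraMap K L)).mulVec ↔ Injective M.mulVec := by
  rw [mulVec_injective_iff, mulVec_injective_iff,
    ← linearIndependent_algebraMap_comp_iff (S := L) (v := M.col)]
  rfl

variable [DecidableEq κ] {A : Matrix κ κ K} {s : K}

theorem isUnit_scalar_sub_iff : IsUnit (scalar κ s - A) ↔ A.charpoly.eval s ≠ 0 := by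
  rw [isUnit_iff_isUnit_det, ← eval_charpoly, isUnit_iff_ne_zero]

theorem scalar_sub_mulVec (A : Matrix κ κ K) (s : K) (x : κ → K) :
    (scalar κ s - A) *ᵥ x = s • x - A *ᵥ x := by
  rw [sub_mulVec, scalar_apply, ← smul_one_eq_diagonal, smul_mulVec, one_mulVec]

theorem eq_zero_of_mulVec_eq_smul (hs : IsUnit (scalar κ s - A)) {x : κ → K}
    (hx : A *ᵥ x = s • x) : x = 0 := by
  refine mulVec_injective_of_isUnit hs ?_
  rw [scalar_sub_mulVec, hx, sub_self, mulVec_zero]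

theorem vecMul_aeval_mul_eq_zero {B : Matrix κ ι K} {q : κ → K} {p : Polynomial K}
    (h : ∀ k ≤ p.natDegree, q ᵥ* (A ^ k * B) = 0) : q ᵥ* (Polynomial.aeval A p * B) = 0 := by
  rw [Polynomial.aeval_eq_sum_range, Matrix.sum_mul, vecMul_sum]
  refine Finset.sum_eq_zero fun k hk => ?_
  rw [Matrix.smul_mul, vecMul_smul, h k (Finset.mem_range_succ_iff.mp hk), smul_zero]

theorem vecMul_pow_mul_eq_zero_of_forall_lt {B : Matrix κ ι K} {q : κ → K}
    (h : ∀ k < Fintype.card κ, q ᵥ* (A ^ k * B) = 0) (k : ℕ) : q ᵥ* (A ^ k * B) = 0 := by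
  cases isEmpty_or_nonempty κ
  · rw [Subsingleton.elim q 0, zero_vecMul]
  have hdeg : (Polynomial.X ^ k %ₘ A.charpoly).natDegree < Fintype.card κ := by
    rw [← A.charpoly_natDegree_eq_dim]
    refine Polynomial.natDegree_modByMonic_lt _ A.charpoly_monic fun h1 => ?_
    have := A.charpoly_natDegree_eq_dim
    rw [h1, Polynomial.natDegree_one] at this
    exact Fintype.card_ne_zero this.symm
  rw [pow_eq_aeval_mod_charpoly]
  exact vecMul_aeval_mul_eq_zero fun j hj => h j (hj.trans_lt hdeg)

theorem isUnit_scalar_X_sub_map :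
    IsUnit (scalar κ (RatFunc.X : RatFunc K) - A.map (algebraMap K (RatFunc K))) := by
  rw [isUnit_scalar_sub_iff, charpoly_map, Polynomial.eval_map_algebraMap,
    RatFunc.aeval_X_left_eq_algebraMap]
  exact RatFunc.algebraMap_ne_zero A.charpoly_monic.ne_zero

theorem exists_pos_isUnit_add_smul_one (A : Matrix κ κ ℝ) :
    ∃ a : ℝ, 0 < a ∧ IsUnit (A + a • (1 : Matrix κ κ ℝ)) := by
  obtain ⟨a, ha, hs⟩ := (Set.Ioi_infinite (0 : ℝ)).exists_notMem_finite (finite_spectrum (-A))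
  rw [spectrum.notMem_iff, Algebra.algebraMap_eq_smul_one, sub_neg_eq_add, add_comm] at hs
  exact ⟨a, ha, hs⟩

end Field

namespace Realization

variable {K L ι ι' κ ρ σ : Type*} [Field K] [Field L] {s : K}

theorem map_reindex (f : K →+* L) (Z : Realization K ι κ ρ) (e : ι ≃ ι') :
    (Z.reindex e).map f = (Z.map f).reindex e := rfl

theorem map_series [Fintype ρ] (f : K →+* L) (Z₁ : Realization K ι κ ρ)
    (Z₂ : Realization K ι' ρ σ) : (Z₁.series Z₂).map f = (Z₁.map f).series (Z₂.map f) := by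
  simp [map, series, fromBlocks_map, fromCols_map, fromRows_map, Matrix.map_mul]

variable [Fintype ι] [DecidableEq ι] [Fintype ι'] [DecidableEq ι']

theorem map_firstOrder [DecidableEq κ] (f : K →+* L) (a : K) (v : Matrix κ ι K)
    (w : Matrix ι κ K) : (firstOrder a v w).map f = firstOrder (f a) (v.map f) (w.map f) := by
  simp [map, firstOrder, Matrix.map_sub, Matrix.map_mul, Matrix.map_one,
    Matrix.map_smul', -neg_smul]

theorem charpoly_series_A [Fintype ρ] (Z₁ : Realization K ι κ ρ) (Z₂ : Realization K ι' ρ σ) :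
    (Z₁.series Z₂).A.charpoly = Z₁.A.charpoly * Z₂.A.charpoly :=
  charpoly_fromBlocks_zero₁₂ ..

theorem charpoly_firstOrder_A [DecidableEq κ] (a : K) (v : Matrix κ ι K) (w : Matrix ι κ K) :
    (firstOrder a v w).A.charpoly = (Polynomial.X + Polynomial.C a) ^ Fintype.card ι := by
  simp [firstOrder, smul_one_eq_diagonal, charpoly_diagonal]

theorem pencil_reindex (Z : Realization K ι κ ρ) (e : ι ≃ ι') (s : K) :
    (Z.reindex e).pencil s =
      (Z.pencil s).reindex (e.sumCongr (.refl ρ)) (e.sumCongr (.refl κ)) := by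
  ext (i | i) (j | j) <;> simp [reindex, pencil, diagonal_apply]

variable [Fintype κ]

theorem pencil_mulVec_sumElim (Z : Realization K ι κ ρ) (s : K) (x : ι → K) (u : κ → K) :
    Z.pencil s *ᵥ Sum.elim x u =
      Sum.elim (Z.A *ᵥ x + Z.B *ᵥ u - s • x) (Z.C *ᵥ x + Z.D *ᵥ u) := by
  rw [pencil, fromBlocks_mulVec, Sum.elim_comp_inl, Sum.elim_comp_inr, add_mulVec, neg_mulVec,
    scalar_apply, ← smul_one_eq_diagonal, smul_mulVec, one_mulVec]
  congr 1
  abel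

theorem pencil_mulVec_injective_iff {Z : Realization K ι κ ρ} :
    Injective (Z.pencil s).mulVec ↔
      ∀ x u, Z.A *ᵥ x + Z.B *ᵥ u = s • x → Z.C *ᵥ x + Z.D *ᵥ u = 0 → x = 0 ∧ u = 0 := by
  have hker : Injective (Z.pencil s).mulVec ↔ ∀ y, Z.pencil s *ᵥ y = 0 → y = 0 :=
    injective_iff_map_eq_zero (Z.pencil s).mulVecLin
  rw [hker, (Equiv.sumArrowEquivProdArrow ι κ K).symm.surjective.forall, Prod.forall]
  refine forall₂_congr fun x u => ?_
  change Z.pencil s *ᵥ Sum.elim x u = 0 → Sum.elim x u = 0 ↔ _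
  rw [pencil_mulVec_sumElim, ← Sum.elim_zero_zero, Sum.elim_eq_iff, ← Sum.elim_zero_zero,
    Sum.elim_eq_iff, sub_eq_zero, and_imp]

theorem pencil_reindex_mulVec_injective {Z : Realization K ι κ ρ}
    (h : Injective (Z.pencil s).mulVec) (e : ι ≃ ι') :
    Injective ((Z.reindex e).pencil s).mulVec := by
  rw [pencil_reindex, ← rank_eq_card_iff_mulVec_injective, rank_reindex,
    (rank_eq_card_iff_mulVec_injective _).mpr h]
  exact Fintype.card_congr (e.sumCongr (.refl κ))

theorem pencil_series_mulVec_injective [Fintype ρ] {Z₁ : Realization K ι κ ρ}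
    {Z₂ : Realization K ι' ρ σ} (h₁ : Injective (Z₁.pencil s).mulVec)
    (h₂ : Injective (Z₂.pencil s).mulVec) : Injective ((Z₁.series Z₂).pencil s).mulVec := by
  rw [pencil_mulVec_injective_iff] at *
  intro x u hx hy
  obtain ⟨x₁, x₂, rfl⟩ : ∃ x₁ x₂, x = Sum.elim x₁ x₂ := ⟨_, _, (Sum.elim_comp_inl_inr x).symm⟩
  have hsmul : s • Sum.elim x₁ x₂ = Sum.elim (s • x₁) (s • x₂) := Sum.comp_elim (s • ·) x₁ x₂
  dsimp only [series] at hx hy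
  rw [fromBlocks_mulVec, fromRows_mulVec, ← Sum.elim_add_add, hsmul, Sum.elim_eq_iff,
    Sum.elim_comp_inl, Sum.elim_comp_inr, zero_mulVec, add_zero] at hx
  rw [fromCols_mulVec_sumElim] at hy
  obtain ⟨hx₁, hx₂⟩ := hx
  obtain ⟨rfl, hy₁⟩ : x₂ = 0 ∧ Z₁.C *ᵥ x₁ + Z₁.D *ᵥ u = 0 := by
    refine h₂ x₂ _ (.trans ?_ hx₂) (.trans ?_ hy) <;>
      simp only [mulVec_add, mulVec_mulVec] <;> abel
  obtain ⟨rfl, rfl⟩ := h₁ x₁ u hx₁ hy₁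
  exact ⟨Sum.elim_zero_zero, rfl⟩

theorem pencil_firstOrder_mulVec_injective [DecidableEq κ] {v : Matrix κ ι K}
    {w : Matrix ι κ K} (hwv : w * v = 1) (a s : K) :
    Injective ((firstOrder a v w).pencil s).mulVec := by
  rw [pencil_mulVec_injective_iff]
  intro t u ht hu
  dsimp only [firstOrder] at ht hu
  have ht0 : t = 0 := by
    have := congrArg (w *ᵥ ·) hu
    simpa [mulVec_add, mulVec_mulVec, Matrix.mul_sub, ← Matrix.mul_assoc, hwv] using this
  have hwu : w *ᵥ u = 0 := by simpa [ht0] using ht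
  have hu0 : u = 0 := by simpa [ht0, sub_mulVec, ← mulVec_mulVec, hwu] using hu
  exact ⟨ht0, hu0⟩

theorem pencil_mulVec_injective_of_transfer {Z : Realization K ι κ ρ}
    (hs : IsUnit (scalar ι s - Z.A)) (h : Injective (Z.transfer s).mulVec) :
    Injective (Z.pencil s).mulVec := by
  rw [pencil_mulVec_injective_iff]
  intro x u hx hy
  have hx' : x = (scalar ι s - Z.A)⁻¹ *ᵥ Z.B *ᵥ u := by
    have hx0 : (scalar ι s - Z.A) *ᵥ x = Z.B *ᵥ u := by
      rw [scalar_sub_mulVec, ← hx, add_sub_cancel_left]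
    rw [← hx0, mulVec_mulVec, nonsing_inv_mul _ ((isUnit_iff_isUnit_det _).mp hs), one_mulVec]
  have hu : u = 0 := by
    refine h ?_
    rw [transfer, add_mulVec, ← mulVec_mulVec, ← mulVec_mulVec, ← hx', hy, mulVec_zero]
  refine ⟨?_, hu⟩
  rw [hx', hu, mulVec_zero, mulVec_zero]

end Realization

section Factorization

variable {K L ι ι' κ κ' μ ν ρ : Type*} [Field K] [Field L] [Fintype ν]

/-- The state-space form of a factorization `M = M' Z` of strictly proper systems `M = (A, B, C)`
and `M' = (A, Bb, C)`: the matrix `[T, 1]` maps the states of the series connection of `Z` and `M'`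
to those of `M`, intertwining the two systems. -/
structure IsFactorization [Fintype ι] [Fintype κ'] (A : Matrix ν ν K) (B : Matrix ν κ K)
    (C : Matrix ρ ν K) (Z : Realization K ι κ κ') (Bb : Matrix ν κ' K) (T : Matrix ν ι K) :
    Prop where
  state : A * T = T * Z.A + Bb * Z.C
  output : C * T = 0
  input : B = T * Z.B + Bb * Z.D

namespace IsFactorization

variable {A : Matrix ν ν K} {B : Matrix ν κ K} {C : Matrix ρ ν K} {Bb : Matrix ν κ' K} {s : K}

theorem refl [Fintype κ] [DecidableEq κ] [Fintype ι] [IsEmpty ι] :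
    IsFactorization A B C (⟨0, 0, 0, 1⟩ : Realization K ι κ κ) B 0 := by
  constructor <;> simp

variable [Fintype ι] [Fintype κ'] {Z : Realization K ι κ κ'} {T : Matrix ν ι K}

theorem trans [Fintype ι'] [Fintype μ] {Z' : Realization K ι' κ' μ} {Bb' : Matrix ν μ K}
    {T' : Matrix ν ι' K} (h : IsFactorization A B C Z Bb T)
    (h' : IsFactorization A Bb C Z' Bb' T') :
    IsFactorization A B C (Z.series Z') Bb' (fromCols T T') where
  state := by
    have hT : A * T = T * Z.A + T' * (Z'.B * Z.C) + Bb' * (Z'.D * Z.C) := by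
      rw [h.state, h'.input, Matrix.add_mul, Matrix.mul_assoc, Matrix.mul_assoc, add_assoc]
    rw [Realization.series, mul_fromCols, fromCols_mul_fromBlocks, mul_fromCols, hT, h'.state,
      Matrix.mul_zero, zero_add]
    ext i (j | j) <;> rfl
  output := by rw [mul_fromCols, h.output, h'.output, fromCols_zero]
  input := by
    rw [Realization.series, fromCols_mul_fromRows, h.input, h'.input, Matrix.add_mul,
      Matrix.mul_assoc, Matrix.mul_assoc, add_assoc]

theorem reindex [Fintype ι'] (h : IsFactorization A B C Z Bb T) (e : ι ≃ ι') :
    IsFactorization A B C (Z.reindex e) Bb (T.reindex (.refl ν) e) where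
  state := by
    simp only [Realization.reindex, reindex_apply, submatrix_mul_equiv, Equiv.refl_symm,
      Equiv.coe_refl]
    exact congrArg (·.submatrix id e.symm) h.state
  output := congrArg (·.submatrix id e.symm) h.output
  input := by
    simpa [Realization.reindex] using h.input

theorem map (h : IsFactorization A B C Z Bb T) (f : K →+* L) :
    IsFactorization (A.map f) (B.map f) (C.map f) (Z.map f) (Bb.map f) (T.map f) where
  state := by
    simpa [Realization.map, Matrix.map_add, Matrix.map_mul] using congrArg (·.map f) h.state
  output := by
    simpa [Matrix.map_mul] using congrArg (·.map f) h.output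
  input := by
    simpa [Realization.map, Matrix.map_add, Matrix.map_mul] using congrArg (·.map f) h.input

theorem firstOrder [DecidableEq ν] [DecidableEq ι] [Fintype κ] [DecidableEq κ] {v : Matrix κ ι K}
    {w : Matrix ι κ K} (hwv : w * v = 1) (hv : C * (B * v) = 0) (a : K) :
    IsFactorization A B C (.firstOrder a v w) (B + (A + (a - 1) • 1) * (B * v) * w) (B * v) where
  state := by
    simp only [Realization.firstOrder, Matrix.add_mul, Matrix.mul_assoc, hwv, Matrix.mul_one,
      Matrix.one_mul, Matrix.smul_mul, Matrix.mul_smul]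
    module
  output := hv
  input := by
    have hw : w * (1 - v * w) = 0 := by
      rw [Matrix.mul_sub, ← Matrix.mul_assoc, hwv, Matrix.mul_one, Matrix.one_mul, sub_self]
    rw [Realization.firstOrder, Matrix.add_mul, Matrix.mul_assoc _ w, hw, Matrix.mul_zero,
      add_zero, Matrix.mul_sub, Matrix.mul_one, Matrix.mul_assoc, add_sub_cancel]

variable [DecidableEq ν] [DecidableEq ι]

theorem state_resolvent (h : IsFactorization A B C Z Bb T) (s : K) :
    (scalar ν s - A) * T = T * (scalar ι s - Z.A) - Bb * Z.C := by
  have hs : scalar ν s * T = T * scalar ι s := by ext; simp [mul_comm]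
  rw [Matrix.sub_mul, Matrix.mul_sub, hs, h.state, sub_sub]

theorem transfer_eq_mul (h : IsFactorization A B C Z Bb T) (hA : IsUnit (scalar ν s - A))
    (hZ : IsUnit (scalar ι s - Z.A)) :
    (⟨A, B, C, 0⟩ : Realization K ν κ ρ).transfer s =
      (⟨A, Bb, C, 0⟩ : Realization K ν κ' ρ).transfer s * Z.transfer s := by
  have hres := h.state_resolvent s
  simp only [Realization.transfer, add_zero]
  rw [isUnit_iff_isUnit_det] at hA hZ
  set P := scalar ν s - A
  set Q := scalar ι s - Z.A
  have hTQ : C * P⁻¹ * T * Q = C * P⁻¹ * Bb * Z.C := by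
    have : C * P⁻¹ * (P * T) = 0 := by
      rw [Matrix.mul_assoc, nonsing_inv_mul_cancel_left _ _ hA, h.output]
    rwa [hres, Matrix.mul_sub, sub_eq_zero, ← Matrix.mul_assoc, ← Matrix.mul_assoc] at this
  have hT : C * P⁻¹ * T = C * P⁻¹ * Bb * Z.C * Q⁻¹ := by
    rw [← hTQ, mul_nonsing_inv_cancel_right _ _ hZ]
  rw [h.input, Matrix.mul_add, Matrix.mul_add, ← Matrix.mul_assoc, hT]
  simp only [Matrix.mul_assoc]

theorem pencil_mulVec_injective [Fintype κ] (h : IsFactorization A B C Z Bb T)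
    (hM : Injective ((⟨A, B, C, 0⟩ : Realization K ν κ ρ).pencil s).mulVec)
    (hZ : IsUnit (scalar ι s - Z.A)) (hZs : Surjective (Z.pencil s).mulVec) :
    Injective ((⟨A, Bb, C, 0⟩ : Realization K ν κ' ρ).pencil s).mulVec := by
  rw [Realization.pencil_mulVec_injective_iff] at *
  dsimp only at *
  intro x u hx hy
  obtain ⟨y, hy'⟩ := hZs (Sum.elim 0 u)
  obtain ⟨z, v, rfl⟩ : ∃ z v, y = Sum.elim z v := ⟨_, _, (Sum.elim_comp_inl_inr y).symm⟩
  rw [Realization.pencil_mulVec_sumElim, Sum.elim_eq_iff, sub_eq_zero] at hy'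
  obtain ⟨hz, rfl⟩ := hy'
  have hxz : A *ᵥ (x + T *ᵥ z) + B *ᵥ v = s • (x + T *ᵥ z) := by
    have hATz : A *ᵥ T *ᵥ z = T *ᵥ Z.A *ᵥ z + Bb *ᵥ Z.C *ᵥ z := by
      simp only [mulVec_mulVec, h.state, add_mulVec]
    have hBv : B *ᵥ v = T *ᵥ Z.B *ᵥ v + Bb *ᵥ Z.D *ᵥ v := by
      simp only [mulVec_mulVec, ← add_mulVec, ← h.input]
    rw [mulVec_add, hATz, hBv, smul_add, ← hx, ← mulVec_smul, ← hz]
    simp only [mulVec_add]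
    abel
  obtain ⟨hx0, rfl⟩ := hM _ v hxz (by simpa [mulVec_add, mulVec_mulVec, h.output] using hy)
  obtain rfl : z = 0 := eq_zero_of_mulVec_eq_smul hZ (by simpa using hz)
  simpa using hx0

theorem fromCols_mulVec_injective [Fintype μ] (h : IsFactorization A B C Z Bb T)
    (hM : Injective ((⟨A, Bb, C, 0⟩ : Realization K ν κ' ρ).pencil s).mulVec)
    (hZ : IsUnit (scalar ι s - Z.A)) (hT : Injective T.mulVec) {v : Matrix κ' μ K}
    (hv : Injective v.mulVec) : Injective (fromCols T (Bb * v)).mulVec := by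
  rw [Realization.pencil_mulVec_injective_iff] at hM
  dsimp only at hM
  refine (injective_iff_map_eq_zero (fromCols T (Bb * v)).mulVecLin).mpr fun xy hxy => ?_
  obtain ⟨x, y, rfl⟩ : ∃ x y, xy = Sum.elim x y := ⟨_, _, (Sum.elim_comp_inl_inr xy).symm⟩
  obtain ⟨ξ, rfl⟩ := (mulVec_surjective_iff_isUnit.mpr hZ) x
  rw [mulVecLin_apply, fromCols_mulVec_sumElim, mulVec_mulVec] at hxy
  have hξ : A *ᵥ T *ᵥ ξ + Bb *ᵥ -(Z.C *ᵥ ξ + v *ᵥ y) = s • T *ᵥ ξ := by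
    have hPT : s • T *ᵥ ξ - A *ᵥ T *ᵥ ξ = T *ᵥ (scalar ι s - Z.A) *ᵥ ξ - Bb *ᵥ Z.C *ᵥ ξ := by
      rw [← scalar_sub_mulVec, mulVec_mulVec, h.state_resolvent, sub_mulVec]
      simp only [mulVec_mulVec]
    rw [eq_comm, ← sub_eq_iff_eq_add', hPT, ← sub_eq_zero, ← hxy]
    simp only [mulVec_neg, mulVec_add, mulVec_mulVec]
    abel
  obtain ⟨hTξ, hy⟩ := hM _ _ hξ (by simp [mulVec_mulVec, h.output])
  obtain rfl : ξ = 0 := hT (hTξ.trans (mulVec_zero T).symm)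
  obtain rfl : y = 0 := hv (by simpa using hy)
  simp

/-- Killing the poles of `Z` with its characteristic polynomial turns a functional that annihilates
the reachable space of `Bb` into one that annihilates that of `B`. -/
theorem eq_zero_of_vecMul_pow_mul_eq_zero (h : IsFactorization A B C Z Bb T)
    (hB : ∀ q : ν → K, (∀ k, q ᵥ* (A ^ k * B) = 0) → q = 0)
    (hZ : IsUnit (Polynomial.aeval A Z.A.charpoly)) {q : ν → K}
    (hq : ∀ k, q ᵥ* (A ^ k * Bb) = 0) : q = 0 := by
  have hpow : ∀ k, q ᵥ* (A ^ k * T) = q ᵥ* (T * Z.A ^ k) := by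
    intro k
    induction k with
    | zero => simp
    | succ k ih =>
      rw [pow_succ, pow_succ, Matrix.mul_assoc, h.state, Matrix.mul_add, vecMul_add,
        ← Matrix.mul_assoc _ Bb, ← vecMul_vecMul _ _ Z.C, hq, zero_vecMul, add_zero,
        ← Matrix.mul_assoc, ← vecMul_vecMul, ih, vecMul_vecMul, Matrix.mul_assoc]
  have hT (p : Polynomial K) :
      q ᵥ* (Polynomial.aeval A p * T) = q ᵥ* (T * Polynomial.aeval Z.A p) := by
    simp only [Polynomial.aeval_eq_sum_range, Matrix.sum_mul, Matrix.mul_sum, vecMul_sum,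
      Matrix.smul_mul, Matrix.mul_smul, vecMul_smul, hpow]
  refine vecMul_injective_of_isUnit hZ ((hB _ fun k => ?_).trans (zero_vecMul _).symm)
  set p := Z.A.charpoly * Polynomial.X ^ k
  have hp : Polynomial.aeval Z.A p = 0 := by
    rw [map_mul, aeval_self_charpoly, zero_mul]
  calc q ᵥ* Polynomial.aeval A Z.A.charpoly ᵥ* (A ^ k * B)
      = q ᵥ* (Polynomial.aeval A p * B) := by
        rw [vecMul_vecMul, ← Matrix.mul_assoc, map_mul, map_pow, Polynomial.aeval_X]
    _ = q ᵥ* (Polynomial.aeval A p * T) ᵥ* Z.B + q ᵥ* (Polynomial.aeval A p * Bb) ᵥ* Z.D := by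
        simp only [vecMul_vecMul, ← vecMul_add, Matrix.mul_assoc, ← Matrix.mul_add, ← h.input]
    _ = 0 := by
        rw [hT, hp, vecMul_aeval_mul_eq_zero fun k _ => hq k]
        simp

end IsFactorization

end Factorization

theorem exists_mul_eq_one_and_mul_eq_zero_of_rank_lt {K κ ρ : Type*} [Field K] [Fintype κ]
    {M : Matrix ρ κ K} (hM : M.rank < Fintype.card κ) :
    ∃ (v : Matrix κ (Fin 1) K) (w : Matrix (Fin 1) κ K), w * v = 1 ∧ M * v = 0 := by
  classical
  have hker : ¬ ∀ x, M.mulVecLin x = 0 → x = 0 := fun h =>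
    hM.ne ((rank_eq_card_iff_mulVec_injective M).mpr
      ((injective_iff_map_eq_zero M.mulVecLin).mpr h))
  push Not at hker
  obtain ⟨x, hx, hx0⟩ := hker
  obtain ⟨i, hi⟩ := Function.ne_iff.mp hx0
  refine ⟨replicateCol (Fin 1) x, replicateRow (Fin 1) (Pi.single i (x i)⁻¹), ?_, ?_⟩
  · ext j k
    rw [replicateRow_mul_replicateCol_apply, single_dotProduct, inv_mul_cancel₀ hi,
      Subsingleton.elim j k, one_apply_eq]
  · ext j
    exact congrFun hx j

section TransferMatrix

variable {K ι κ μ ν ρ : Type*} [Field K] [Fintype ι] [DecidableEq ι] [Fintype ν] [DecidableEq ν]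
  [Fintype κ]

/-- The transfer matrix over the field of rational functions: the transfer function at the
indeterminate. -/
noncomputable def Realization.transferMatrix (Z : Realization K ι κ ρ) : Matrix ρ κ (RatFunc K) :=
  (Z.map (algebraMap K (RatFunc K))).transfer RatFunc.X

namespace IsFactorization

variable {A : Matrix ν ν K} {B Bb : Matrix ν κ K} {C : Matrix ρ ν K} {Z : Realization K ι κ κ}
  {T : Matrix ν ι K}

theorem transferMatrix_eq_mul (h : IsFactorization A B C Z Bb T) :
    Realization.transferMatrix ⟨A, B, C, 0⟩ =
      Realization.transferMatrix ⟨A, Bb, C, 0⟩ * Z.transferMatrix := by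
  simpa [Realization.transferMatrix, Realization.map] using
    (h.map (algebraMap K (RatFunc K))).transfer_eq_mul isUnit_scalar_X_sub_map
      isUnit_scalar_X_sub_map

theorem isUnit_transferMatrix [DecidableEq κ] (h : IsFactorization A B C Z Bb T)
    (hM : Injective (Realization.transferMatrix ⟨A, B, C, 0⟩).mulVec) :
    IsUnit Z.transferMatrix := by
  rw [← mulVec_injective_iff_isUnit]
  refine Injective.of_comp (f := (Realization.transferMatrix ⟨A, Bb, C, 0⟩).mulVec) ?_
  rw [h.transferMatrix_eq_mul] at hM
  simpa only [comp_def, mulVec_mulVec] using hM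

theorem transferMatrix_eq_mul_inv [DecidableEq κ] (h : IsFactorization A B C Z Bb T)
    (hM : Injective (Realization.transferMatrix ⟨A, B, C, 0⟩).mulVec) :
    Realization.transferMatrix ⟨A, Bb, C, 0⟩ =
      Realization.transferMatrix ⟨A, B, C, 0⟩ * Z.transferMatrix⁻¹ := by
  rw [h.transferMatrix_eq_mul, mul_nonsing_inv_cancel_right]
  exact (isUnit_iff_isUnit_det _).mp (h.isUnit_transferMatrix hM)

omit [DecidableEq ι] in
theorem fromCols_mulVec_injective_of_transferMatrix [Fintype μ]
    (h : IsFactorization A B C Z Bb T)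
    (hM : Injective (Realization.transferMatrix ⟨A, B, C, 0⟩).mulVec) (hT : Injective T.mulVec)
    {v : Matrix κ μ K} (hv : Injective v.mulVec) : Injective (fromCols T (Bb * v)).mulVec := by
  classical
  have hM' : Injective (Realization.transferMatrix ⟨A, Bb, C, 0⟩).mulVec := by
    have hZ := isUnit_nonsing_inv_iff.mpr (h.isUnit_transferMatrix hM)
    rw [h.transferMatrix_eq_mul_inv hM]
    simpa only [comp_def, mulVec_mulVec] using hM.comp (mulVec_injective_of_isUnit hZ)
  have hpencil := Realization.pencil_mulVec_injective_of_transfer isUnit_scalar_X_sub_map hM'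
  rw [← map_algebraMap_mulVec_injective_iff (L := RatFunc K)] at hT hv ⊢
  rw [fromCols_map, Matrix.map_mul]
  refine (h.map _).fromCols_mulVec_injective (s := RatFunc.X) ?_ isUnit_scalar_X_sub_map hT hv
  simpa [Realization.map] using hpencil

end IsFactorization

end TransferMatrix

section Extraction

variable {ι ι' κ μ ν ρ : Type*} [Fintype ι] [DecidableEq ι] [Fintype μ] [Fintype ν]

/-- A factorization `(A, B, C) = (A, Bb, C) Z` in which `Z` has no finite zeros and all its poles
are at `-a`, so that only zeros at infinity of `(A, B, C)` have been moved into `Z`. -/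
structure IsInfiniteZeroExtraction (a : ℝ) (A : Matrix ν ν ℝ) (B : Matrix ν μ ℝ)
    (C : Matrix ρ ν ℝ) (Z : Realization ℝ ι μ μ) (Bb : Matrix ν μ ℝ)
    (T : Matrix ν ι ℝ) : Prop extends IsFactorization A B C Z Bb T where
  charpoly_eq : Z.A.charpoly = (Polynomial.X + Polynomial.C a) ^ Fintype.card ι
  pencil_injective (s : ℂ) : Injective ((Z.map (algebraMap ℝ ℂ)).pencil s).mulVec
  injective : Injective T.mulVec

namespace IsInfiniteZeroExtraction

variable {a : ℝ} {A : Matrix ν ν ℝ} {B Bb : Matrix ν μ ℝ} {C : Matrix ρ ν ℝ}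
  {Z : Realization ℝ ι μ μ} {T : Matrix ν ι ℝ}

theorem reindex [Fintype ι'] [DecidableEq ι']
    (h : IsInfiniteZeroExtraction a A B C Z Bb T) (e : ι ≃ ι') :
    IsInfiniteZeroExtraction a A B C (Z.reindex e) Bb (T.reindex (.refl ν) e) where
  toIsFactorization := h.toIsFactorization.reindex e
  charpoly_eq := by
    rw [Realization.reindex, charpoly_reindex, h.charpoly_eq, Fintype.card_congr e]
  pencil_injective s := by
    rw [Realization.map_reindex]
    exact Realization.pencil_reindex_mulVec_injective (h.pencil_injective s) e
  injective := by
    rw [← rank_eq_card_iff_mulVec_injective, rank_reindex, ← Fintype.card_congr e,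
      rank_eq_card_iff_mulVec_injective]
    exact h.injective

theorem card_le (h : IsInfiniteZeroExtraction a A B C Z Bb T) :
    Fintype.card ι ≤ Fintype.card ν := by
  rw [← (rank_eq_card_iff_mulVec_injective T).mpr h.injective]
  exact T.rank_le_card_height

theorem isUnit_scalar_sub (h : IsInfiniteZeroExtraction a A B C Z Bb T) (ha : 0 < a) {s : ℂ}
    (hs : 0 ≤ s.re) : IsUnit (scalar ι s - Z.A.map (algebraMap ℝ ℂ)) := by
  have hsa : s + a ≠ 0 := fun h0 => by
    have := congrArg Complex.re h0
    simp only [Complex.add_re, Complex.ofReal_re, Complex.zero_re] at this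
    linarith
  rw [isUnit_scalar_sub_iff, charpoly_map, h.charpoly_eq]
  simpa using fun h0 => absurd h0 hsa

theorem refl [IsEmpty ι] [DecidableEq μ] :
    IsInfiniteZeroExtraction a A B C (⟨0, 0, 0, 1⟩ : Realization ℝ ι μ μ) B 0 where
  toIsFactorization := .refl
  charpoly_eq := by simp
  pencil_injective s := by
    rw [Realization.pencil_mulVec_injective_iff]
    intro x u _ hu
    exact ⟨Subsingleton.elim _ _, by simpa [Realization.map] using hu⟩
  injective := injective_of_subsingleton _

variable [DecidableEq ν]

theorem isUnit_aeval_charpoly (h : IsInfiniteZeroExtraction a A B C Z Bb T)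
    (ha : IsUnit (A + a • (1 : Matrix ν ν ℝ))) : IsUnit (Polynomial.aeval A Z.A.charpoly) := by
  rw [h.charpoly_eq, map_pow, map_add, Polynomial.aeval_X, Polynomial.aeval_C,
    Algebra.algebraMap_eq_smul_one]
  exact ha.pow _

theorem extend [Fintype κ] [DecidableEq κ] [DecidableEq μ]
    (h : IsInfiniteZeroExtraction a A B C Z Bb T)
    (hM : Injective (Realization.transferMatrix ⟨A, B, C, 0⟩).mulVec)
    {v : Matrix μ κ ℝ} {w : Matrix κ μ ℝ} (hwv : w * v = 1) (hv : C * (Bb * v) = 0) :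
    IsInfiniteZeroExtraction a A B C (Z.series (.firstOrder a v w))
      (Bb + (A + (a - 1) • 1) * (Bb * v) * w) (fromCols T (Bb * v)) where
  toIsFactorization := h.toIsFactorization.trans (.firstOrder hwv hv a)
  charpoly_eq := by
    rw [Realization.charpoly_series_A, h.charpoly_eq, Realization.charpoly_firstOrder_A, ← pow_add,
      Fintype.card_sum]
  pencil_injective s := by
    have hwv' : w.map (algebraMap ℝ ℂ) * v.map (algebraMap ℝ ℂ) = 1 := by
      rw [← Matrix.map_mul, hwv, Matrix.map_one _ (map_zero _) (map_one _)]
    rw [Realization.map_series, Realization.map_firstOrder]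
    exact Realization.pencil_series_mulVec_injective (h.pencil_injective s)
      (Realization.pencil_firstOrder_mulVec_injective hwv' _ s)
  injective :=
    have hv : Injective v.mulVec :=
      LeftInverse.injective (g := w.mulVec) fun x => by rw [mulVec_mulVec, hwv, one_mulVec]
    h.fromCols_mulVec_injective_of_transferMatrix hM h.injective hv

theorem exists_succ {k : ℕ} {Z : Realization ℝ (Fin k) μ μ} {T : Matrix ν (Fin k) ℝ}
    (h : IsInfiniteZeroExtraction a A B C Z Bb T)
    (hM : Injective (Realization.transferMatrix ⟨A, B, C, 0⟩).mulVec)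
    (hrank : (C * Bb).rank < Fintype.card μ) :
    ∃ (Z' : Realization ℝ (Fin (k + 1)) μ μ) (Bb' : Matrix ν μ ℝ) (T' : Matrix ν (Fin (k + 1)) ℝ),
      IsInfiniteZeroExtraction a A B C Z' Bb' T' := by
  classical
  obtain ⟨v, w, hwv, hv⟩ := exists_mul_eq_one_and_mul_eq_zero_of_rank_lt hrank
  rw [Matrix.mul_assoc] at hv
  exact ⟨_, _, _, (h.extend hM hwv hv).reindex finSumFinEquiv⟩

end IsInfiniteZeroExtraction

theorem exists_isInfiniteZeroExtraction_rank_eq [DecidableEq ν] (a : ℝ) {A : Matrix ν ν ℝ}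
    {B : Matrix ν μ ℝ} {C : Matrix ρ ν ℝ}
    (hM : Injective (Realization.transferMatrix ⟨A, B, C, 0⟩).mulVec) :
    ∃ (k : ℕ) (Z : Realization ℝ (Fin k) μ μ) (Bb : Matrix ν μ ℝ) (T : Matrix ν (Fin k) ℝ),
      IsInfiniteZeroExtraction a A B C Z Bb T ∧ (C * Bb).rank = Fintype.card μ := by
  classical
  by_contra! hne
  have hall (k : ℕ) : ∃ (Z : Realization ℝ (Fin k) μ μ) (Bb : Matrix ν μ ℝ)
      (T : Matrix ν (Fin k) ℝ), IsInfiniteZeroExtraction a A B C Z Bb T := by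
    induction k with
    | zero => exact ⟨_, _, _, .refl⟩
    | succ k ih =>
      obtain ⟨Z, Bb, T, h⟩ := ih
      exact h.exists_succ hM ((C * Bb).rank_le_card_width.lt_of_ne (hne k Z Bb T h))
  obtain ⟨Z, Bb, T, h⟩ := hall (Fintype.card ν + 1)
  have := h.card_le
  rw [Fintype.card_fin] at this
  omega

end Extraction

section Fin

variable {n m p k : ℕ} {A : Matrix (Fin n) (Fin n) ℝ} {B Bb : Matrix (Fin n) (Fin m) ℝ}
  {C : Matrix (Fin p) (Fin n) ℝ}

theorem isControllable_iff :
    IsControllable A B ↔ ∀ q, (∀ k, q ᵥ* (A ^ k * B) = 0) → q = 0 := by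
  have hker (q : Fin n → ℝ) :
      (of fun (i : Fin n) (l : Fin n × Fin m) => (A ^ (l.1 : ℕ) * B) i l.2)ᵀ *ᵥ q = 0 ↔
        ∀ k < n, q ᵥ* (A ^ k * B) = 0 := by
    rw [mulVec_transpose, funext_iff, Prod.forall]
    exact ⟨fun h k hk => funext (h ⟨k, hk⟩), fun h k => congrFun (h k k.2)⟩
  have hrank := rank_eq_card_iff_mulVec_injective
    (of fun (i : Fin n) (l : Fin n × Fin m) => (A ^ (l.1 : ℕ) * B) i l.2)ᵀ
  rw [rank_transpose, Fintype.card_fin] at hrank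
  refine (hrank.trans (injective_iff_map_eq_zero (mulVecLin _))).trans (forall_congr' fun q => ?_)
  rw [mulVecLin_apply, hker]
  refine imp_congr_left ⟨fun h => ?_, fun h k _ => h k⟩
  exact vecMul_pow_mul_eq_zero_of_forall_lt (by rwa [Fintype.card_fin])

theorem not_isTransmissionZero_iff (hmp : m ≤ p) {D : Matrix (Fin p) (Fin m) ℝ} {s : ℂ} :
    ¬ IsTransmissionZero A B C D s ↔ Injective (systemMatrix A B C D s).mulVec := by
  rw [← rank_eq_card_iff_mulVec_injective, IsTransmissionZero, min_eq_left hmp, not_lt]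
  have := (systemMatrix A B C D s).rank_le_card_width
  simp only [Fintype.card_sum, Fintype.card_fin] at this ⊢
  omega

namespace IsInfiniteZeroExtraction

variable {a : ℝ} {Z : Realization ℝ (Fin k) (Fin m) (Fin m)} {T : Matrix (Fin n) (Fin k) ℝ}

theorem isHurwitz (h : IsInfiniteZeroExtraction a A B C Z Bb T) (ha : 0 < a) :
    IsHurwitz Z.A := by
  intro s hs
  by_contra! hre
  exact spectrum.mem_iff.mp hs (h.isUnit_scalar_sub ha hre)

theorem isControllable (h : IsInfiniteZeroExtraction a A B C Z Bb T)
    (ha : IsUnit (A + a • (1 : Matrix (Fin n) (Fin n) ℝ))) (hB : IsControllable A B) :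
    IsControllable A Bb := by
  rw [isControllable_iff] at *
  exact fun q => h.eq_zero_of_vecMul_pow_mul_eq_zero hB (h.isUnit_aeval_charpoly ha)

theorem det_systemMatrix_ne_zero (h : IsInfiniteZeroExtraction a A B C Z Bb T) (s : ℂ) :
    (systemMatrix Z.A Z.B Z.C Z.D s).det ≠ 0 := by
  rw [← isUnit_iff_ne_zero, ← isUnit_iff_isUnit_det, ← mulVec_injective_iff_isUnit]
  exact h.pencil_injective s

theorem noUnstableZeros (h : IsInfiniteZeroExtraction a A B C Z Bb T) (ha : 0 < a) (hmp : m ≤ p)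
    (hB : NoUnstableZeros A B C 0) : NoUnstableZeros A Bb C 0 := by
  intro s hs
  by_contra! hre
  have hinj := (not_isTransmissionZero_iff hmp).mp fun hs' => (hB s hs').not_ge hre
  have hZ : Surjective ((Z.map (algebraMap ℝ ℂ)).pencil s).mulVec :=
    mulVec_surjective_iff_isUnit.mpr (mulVec_injective_iff_isUnit.mp (h.pencil_injective s))
  have hmap (B : Matrix (Fin n) (Fin m) ℝ) : systemMatrix A B C 0 s = Realization.pencil
      ⟨A.map (algebraMap ℝ ℂ), B.map (algebraMap ℝ ℂ), C.map (algebraMap ℝ ℂ), 0⟩ s := by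
    simp [systemMatrix, Realization.pencil]
  rw [hmap] at hinj
  refine (not_isTransmissionZero_iff hmp).mpr ?_ hs
  rw [hmap]
  exact (h.map (algebraMap ℝ ℂ)).pencil_mulVec_injective hinj (h.isUnit_scalar_sub ha hre) hZ

end IsInfiniteZeroExtraction

end Fin

end LTI

theorem corollary1_general {n m p : ℕ} (Am : Matrix (Fin n) (Fin n) ℝ)
    (Bm : Matrix (Fin n) (Fin m) ℝ) (Cm : Matrix (Fin p) (Fin n) ℝ)
    (hrank : (LTI.transferMatrix Am Bm Cm 0).rank = m) :
    ∃ (nz : ℕ) (Az : Matrix (Fin nz) (Fin nz) ℝ) (Bz : Matrix (Fin nz) (Fin m) ℝ)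
      (Cz : Matrix (Fin m) (Fin nz) ℝ) (Dz : Matrix (Fin m) (Fin m) ℝ)
      (Bbar : Matrix (Fin n) (Fin m) ℝ) (Tz : Matrix (Fin n) (Fin nz) ℝ),
      LTI.IsHurwitz Az ∧
      (∀ s : ℂ, (LTI.systemMatrix Az Bz Cz Dz s).det ≠ 0) ∧
      IsUnit (LTI.transferMatrix Az Bz Cz Dz) ∧
      LTI.transferMatrix Am Bbar Cm 0 =
        LTI.transferMatrix Am Bm Cm 0 * (LTI.transferMatrix Az Bz Cz Dz)⁻¹ ∧
      Am * Tz = Tz * Az + Bbar * Cz ∧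
      Cm * Am * Tz = Cm * Bbar * Cz ∧
      Bm = Tz * Bz + Bbar * Dz ∧
      Cm * Bm = Cm * Bbar * Dz ∧
      Tz.rank = nz ∧
      (LTI.IsControllable Am Bm → LTI.IsControllable Am Bbar) ∧
      (Cm * Bbar).rank = m ∧
      (LTI.NoUnstableZeros Am Bm Cm 0 → LTI.NoUnstableZeros Am Bbar Cm 0) := by
  have hmp : m ≤ p := hrank ▸ Matrix.rank_le_height _
  have hM : Function.Injective (LTI.transferMatrix Am Bm Cm 0).mulVec :=
    (LTI.rank_eq_card_iff_mulVec_injective _).mp (hrank.trans (Fintype.card_fin m).symm)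
  obtain ⟨a, ha, hAm⟩ := LTI.exists_pos_isUnit_add_smul_one Am
  obtain ⟨nz, Z, Bbar, Tz, hZ, hCB⟩ := LTI.exists_isInfiniteZeroExtraction_rank_eq a hM
  have hTz := (LTI.rank_eq_card_iff_mulVec_injective Tz).mpr hZ.injective
  rw [Fintype.card_fin] at hCB hTz
  refine ⟨nz, Z.A, Z.B, Z.C, Z.D, Bbar, Tz, hZ.isHurwitz ha, hZ.det_systemMatrix_ne_zero,
    hZ.isUnit_transferMatrix hM, hZ.transferMatrix_eq_mul_inv hM, hZ.state, ?_, hZ.input, ?_, hTz,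
    hZ.isControllable hAm, hCB, hZ.noUnstableZeros ha hmp⟩
  · rw [Matrix.mul_assoc, hZ.state, Matrix.mul_add, ← Matrix.mul_assoc, hZ.output,
      Matrix.zero_mul, zero_add, Matrix.mul_assoc]
  · rw [hZ.input, Matrix.mul_add, ← Matrix.mul_assoc, hZ.output, Matrix.zero_mul, zero_add,
      Matrix.mul_assoc]

theorem corollary1 {n m p : ℕ} (hmp : m ≤ p) (hpn : p ≤ n)
    (Am : Matrix (Fin n) (Fin n) ℝ) (Bm : Matrix (Fin n) (Fin m) ℝ)
    (Cm : Matrix (Fin p) (Fin n) ℝ)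
    (hmin : LTI.IsMinimal Am Bm Cm) (hstab : LTI.IsHurwitz Am)
    (hrank : (LTI.transferMatrix Am Bm Cm 0).rank = m)
    (hdef : (Cm * Bm).rank < m) :
    ∃ (nz : ℕ) (Az : Matrix (Fin nz) (Fin nz) ℝ) (Bz : Matrix (Fin nz) (Fin m) ℝ)
      (Cz : Matrix (Fin m) (Fin nz) ℝ) (Dz : Matrix (Fin m) (Fin m) ℝ)
      (Bbar : Matrix (Fin n) (Fin m) ℝ) (Tz : Matrix (Fin n) (Fin nz) ℝ),
      -- `Z` is stable and invertible, and its system matrix is nonsingular everywhere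
      LTI.IsHurwitz Az ∧
      (∀ s : ℂ, (LTI.systemMatrix Az Bz Cz Dz s).det ≠ 0) ∧
      IsUnit (LTI.transferMatrix Az Bz Cz Dz) ∧
      -- the factorization
      LTI.transferMatrix Am Bbar Cm 0 =
        LTI.transferMatrix Am Bm Cm 0 * (LTI.transferMatrix Az Bz Cz Dz)⁻¹ ∧
      -- the state-space identities
      Am * Tz = Tz * Az + Bbar * Cz ∧
      Cm * Am * Tz = Cm * Bbar * Cz ∧
      Bm = Tz * Bz + Bbar * Dz ∧
      Cm * Bm = Cm * Bbar * Dz ∧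
      Tz.rank = nz ∧
      LTI.IsControllable Am Bbar ∧
      (Cm * Bbar).rank = m ∧
      (LTI.NoUnstableZeros Am Bm Cm 0 → LTI.NoUnstableZeros Am Bbar Cm 0) := by
  obtain ⟨nz, Az, Bz, Cz, Dz, Bbar, Tz, hAz, hdet, hunit, hfac, h₁, h₂, h₃, h₄, hT, hctrb, h⟩ :=
    corollary1_general Am Bm Cm hrank
  exact ⟨nz, Az, Bz, Cz, Dz, Bbar, Tz, hAz, hdet, hunit, hfac, h₁, h₂, h₃, h₄, hT, hctrb hmin.1, h⟩
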